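/- Let $\mathbb{H}$ be the real quaternions and $\mathbb{DH}=\{p+\varepsilon q : p,q\in\mathbb{H}\}$ the dual quaternions, where $\varepsilon$ is central and $\varepsilon^2=0$. The conjugate of $p+\varepsilon q$ is $\overline{p}+\varepsilon\overline{q}$; conjugation acts coefficientwise on $\mathbb{DH}[t]$, where the indeterminate $t$ commutes with all coefficients. A polynomial $C=P+\varepsilon Q\in\mathbb{DH}[t]$ with $P,Q\in\mathbb{H}[t]$ is called a motion polynomial if $\nu(C):=C\overline{C}=\overline{C}C$ is a nonzero polynomial in $\mathbb{R}[t]$. For $0\neq P\in\mathbb{H}[t]$ let $\operatorname{mrpf}(P)\in\mathbb{R}[t]$ be the unique monic real polynomial factor of $P$ of maximal degree. A motion polynomial $C=P+\varepsilon Q$ is called bounded if $\operatorname{mrpf}(P)$ has no real zeros, and unbounded otherwise. Theorem. Let $C=P+\varepsilon Q\in\mathbb{DH}[t]$ be an unbounded motion polynomial whose leading coefficient is invertible in $\mathbb{DH}$ (for instance, a monic one), and suppose that every real zero of $\operatorname{mrpf}(P)$ has multiplicity one. Then there is a nonzero real polynomial $D\in\mathbb{R}[t]$ such that $CD$ admits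 a factorization with linear motion polynomial factors, that is, $CD=c\,(t-h_1)(t-h_2)\cdots(t-h_n)$ with $n=\deg(CD)\ge 1$ and $c,h_1,\dots,h_n\in\mathbb{DH}$, where every $t-h_i$ is a motion polynomial. -/

import Mathlib

open Polynomial Quaternion DualNumber

namespace MotionPoly

/-- The algebra of dual quaternions: elements `p + ε q` with real quaternions `p`, `q`,
where `ε` commutes with everything and `ε * ε = 0`. -/
abbrev DualQuat : Type := DualNumber ℍ[ℝ]

/-- Conjugation of dual quaternions, `p + ε q ↦ p̄ + ε q̄`. -/
noncomputable def dqConj (a : DualQuat) : DualQuat :=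
  TrivSqZeroExt.inl (star a.fst) + TrivSqZeroExt.inr (star a.snd)

/-- Coefficientwise conjugation of polynomials over the dual quaternions. -/
noncomputable def polyConj (F : DualQuat[X]) : DualQuat[X] :=
  F.sum fun i a => monomial i (dqConj a)

theorem coeff_polyConj (F : DualQuat[X]) (n : ℕ) :
    (polyConj F).coeff n = dqConj (F.coeff n) := by
  have h0 : dqConj 0 = 0 := by simp [dqConj]
  simp only [polyConj, Polynomial.sum, finsetSum_coeff, coeff_monomial, Finset.sum_ite_eq']
  split_ifs with h
  · rfl
  · rw [notMem_support_iff.mp h, h0]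

/-- A real polynomial, seen as a polynomial over the dual quaternions. -/
noncomputable def ofReal (D : ℝ[X]) : DualQuat[X] := D.map (algebraMap ℝ DualQuat)

/-- The norm polynomial `ν(F) = F F̄`. -/
noncomputable def normPoly (F : DualQuat[X]) : DualQuat[X] := F * polyConj F

/-- Motion polynomials: the norm polynomial `F F̄ = F̄ F` is real and nonzero. -/
def IsMotionPolynomial (F : DualQuat[X]) : Prop :=
  (∃ N : ℝ[X], normPoly F = ofReal N ∧ polyConj F * F = ofReal N) ∧ normPoly F ≠ 0

/-- The primal part `P` of `F = P + ε Q`. -/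
noncomputable def primalPart (F : DualQuat[X]) : ℍ[ℝ][X] :=
  F.map (TrivSqZeroExt.fstHom ℝ ℍ[ℝ] ℍ[ℝ] : DualQuat →+* ℍ[ℝ])

/-- The real polynomial `p` is a factor of the quaternion polynomial `P`
(real polynomials are central, so left and right factors agree). -/
def IsRealFactor (p : ℝ[X]) (P : ℍ[ℝ][X]) : Prop := p.map (algebraMap ℝ ℍ[ℝ]) ∣ P

/-- `p` is a monic real polynomial factor of `P` of maximal degree. -/
def IsMaxRealFactor (p : ℝ[X]) (P : ℍ[ℝ][X]) : Prop :=
  p.Monic ∧ IsRealFactor p P ∧ ∀ q : ℝ[X], IsRealFactor q P → q.natDegree ≤ p.natDegree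

theorem exists_isMaxRealFactor {P : ℍ[ℝ][X]} (hP : P ≠ 0) : ∃ p, IsMaxRealFactor p P := by
  classical
  have hb : ∀ q : ℝ[X], IsRealFactor q P → q.natDegree ≤ P.natDegree := by
    rintro q ⟨G, hG⟩
    have h1 : G ≠ 0 := by rintro rfl; simp at hG; exact hP hG
    have h2 : q.map (algebraMap ℝ ℍ[ℝ]) ≠ 0 := by
      intro h; rw [h, zero_mul] at hG; exact hP hG
    rw [hG, natDegree_mul h2 h1, natDegree_map]
    omega
  let T : ℕ → Prop := fun n => ∃ q : ℝ[X], q.Monic ∧ IsRealFactor q P ∧ q.natDegree = n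
  have hT0 : T 0 := ⟨1, monic_one, by simp [IsRealFactor], by simp⟩
  obtain ⟨p, hpm, hpf, hpn⟩ : T (Nat.findGreatest T P.natDegree) :=
    Nat.findGreatest_spec (Nat.zero_le _) hT0
  refine ⟨p, hpm, hpf, fun q hq => ?_⟩
  rw [hpn]
  apply Nat.le_findGreatest (hb q hq)
  have hq0 : q ≠ 0 := by
    rintro rfl
    simp [IsRealFactor] at hq
    exact hP hq
  have hu : IsUnit (C (q.leadingCoeff⁻¹ : ℝ)) :=
    isUnit_C.mpr (inv_ne_zero (leadingCoeff_ne_zero.mpr hq0)).isUnit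
  refine ⟨q * C q.leadingCoeff⁻¹, monic_mul_leadingCoeff_inv hq0, ?_, ?_⟩
  · unfold IsRealFactor
    rw [Polynomial.map_mul]
    obtain ⟨G, hG⟩ := hq
    refine ⟨C (algebraMap ℝ ℍ[ℝ] q.leadingCoeff) * G, ?_⟩
    rw [map_C, mul_assoc, ← mul_assoc (C _) (C _) G, ← C_mul, ← map_mul,
      inv_mul_cancel₀ (leadingCoeff_ne_zero.mpr hq0), map_one, C_1, one_mul, hG]
  · exact natDegree_mul_C (inv_ne_zero (leadingCoeff_ne_zero.mpr hq0))

theorem IsMaxRealFactor.unique {P : ℍ[ℝ][X]} {p q : ℝ[X]}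
    (hp : IsMaxRealFactor p P) (hq : IsMaxRealFactor q P) : p = q := by
  classical
  have key : ∀ {p q : ℝ[X]}, IsMaxRealFactor p P → IsMaxRealFactor q P → q ∣ p := by
    intro p q hp hq
    obtain ⟨hpm, ⟨G, hG⟩, hpx⟩ := hp
    obtain ⟨hqm, ⟨H, hH⟩, -⟩ := hq
    have hd0 : EuclideanDomain.gcd p q ≠ 0 := fun h =>
      hpm.ne_zero (EuclideanDomain.gcd_eq_zero_iff.mp h).1
    have hbez := EuclideanDomain.gcd_eq_gcd_ab p q
    obtain ⟨p', hp'⟩ := EuclideanDomain.gcd_dvd_left p q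
    obtain ⟨q', hq'⟩ := EuclideanDomain.gcd_dvd_right p q
    generalize EuclideanDomain.gcdA p q = a at hbez
    generalize EuclideanDomain.gcdB p q = b at hbez
    generalize EuclideanDomain.gcd p q = d at *
    let φ := mapRingHom (algebraMap ℝ ℍ[ℝ])
    have hφ : ∀ r : ℝ[X], r.map (algebraMap ℝ ℍ[ℝ]) = φ r := fun _ => rfl
    have hl : φ d * P = φ d * (φ (d * p' * q') * (φ b * G + φ a * H)) := by
      have e1 : φ (p * a) * P = φ (d * (d * p' * q')) * (φ a * H) := by
        have : p * a * q = d * (d * p' * q') * a := by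
          conv_lhs => rw [hp', hq']
          ring
        rw [hH, hφ, ← mul_assoc, ← map_mul, this, map_mul, mul_assoc]
      have e2 : φ (q * b) * P = φ (d * (d * p' * q')) * (φ b * G) := by
        have : q * b * p = d * (d * p' * q') * b := by
          conv_lhs => rw [hp', hq']
          ring
        rw [hG, hφ, ← mul_assoc, ← map_mul, this, map_mul, mul_assoc]
      rw [← mul_assoc, ← map_mul, mul_add, ← e1, ← e2, ← add_mul, ← map_add, add_comm, ← hbez]
    have hφd : φ d ≠ 0 := by
      rw [← hφ]
      exact (Polynomial.map_ne_zero_iff (algebraMap ℝ ℍ[ℝ]).injective).mpr hd0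
    have hP' := mul_left_cancel₀ hφd hl
    have hdeg := hpx (d * p' * q') ⟨_, hP'⟩
    have hq0 : q' ≠ 0 := by
      rintro rfl
      exact hqm.ne_zero (by rw [hq', mul_zero])
    rw [← hp', natDegree_mul hpm.ne_zero hq0] at hdeg
    have hu : IsUnit q' := by
      rw [isUnit_iff_degree_eq_zero, degree_eq_natDegree hq0]
      have : q'.natDegree = 0 := by omega
      simp [this]
    obtain ⟨u, rfl⟩ := hu
    rw [hq', Units.mul_right_dvd]
    exact ⟨p', hp'⟩
  exact eq_of_monic_of_associated hp.1 hq.1 (associated_of_dvd_dvd (key hq hp) (key hp hq))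

open Classical in
/-- The maximal real polynomial factor of `P`: the unique monic real factor of maximal degree
(for `P = 0` there is none, and the value is `0`). -/
noncomputable def mrpf (P : ℍ[ℝ][X]) : ℝ[X] :=
  if h : ∃ p, IsMaxRealFactor p P then h.choose else 0

theorem mrpf_eq_iff {P : ℍ[ℝ][X]} (hP : P ≠ 0) {p : ℝ[X]} :
    mrpf P = p ↔ IsMaxRealFactor p P := by
  have h := exists_isMaxRealFactor hP
  have hs : IsMaxRealFactor (mrpf P) P := by
    rw [mrpf, dif_pos h]
    exact h.choose_spec
  exact ⟨fun e => e ▸ hs, fun hp => hs.unique hp⟩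

/-- A motion polynomial is bounded if the maximal real polynomial factor of its primal part has
no real zeros. -/
def IsBounded (F : DualQuat[X]) : Prop := ∀ a : ℝ, ¬ (mrpf (primalPart F)).IsRoot a

/-- `F` admits a factorization `F = c (t - h₁) ⋯ (t - hₙ)`, `n = deg F ≥ 1`, in which all the
linear factors `t - hᵢ` are motion polynomials. -/
def AdmitsMotionFactorization (F : DualQuat[X]) : Prop :=
  1 ≤ F.natDegree ∧ ∃ (c : DualQuat) (h : List DualQuat), h.length = F.natDegree ∧
    (∀ x ∈ h, IsMotionPolynomial (X - C x)) ∧ F = C c * (h.map fun x => X - C x).prod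

end MotionPoly

/-!
Write `C = P + εQ` with `P = pG` and `p = mrpf P`, and let `N = GḠ`. Then
`CN = (pN + εQḠ) G`: up to a real factor, `C` is a translation times a polynomial over `ℍ`.
Polynomials over `ℍ` split into linear factors because the real polynomial `PP̄` has a complex root.

Whether a translation `A + εV` factors up to a real polynomial depends only on the fraction `V/A`.
Multiplying translations adds their fractions, and conjugation by `P ∈ ℍ[t]` turns `V/A` into
`PVP̄/(APP̄)`. Since `pN` has no multiple real root, partial fractions of `QḠ/(pN)` are of the form
`u/(t - a)`, which belongs to a linear polynomial, or `(rs + c) u/M^k` with `s = t - a` and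
`M = s² + b²`. For a unit `n` orthogonal to `u`, conjugation by `s ± bn` rotates `u/M^(k-1)` within
the plane of `u` and `nu`, and sums of such rotations produce the fractions with denominator `M^k`.
-/

namespace MotionPoly

attribute [local instance] Polynomial.algebra

section StarRing

variable {R : Type*} [Semiring R] [StarRing R]

/-- Coefficientwise conjugation of polynomials; the indeterminate is self-adjoint. -/
noncomputable instance : Star R[X] :=
  ⟨fun P => P.sum fun i a => monomial i (star a)⟩

theorem coeff_star (P : R[X]) (n : ℕ) : (star P).coeff n = star (P.coeff n) := by
  simp only [star, Polynomial.sum, finsetSum_coeff, coeff_monomial, Finset.sum_ite_eq']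
  split_ifs with h
  · rfl
  · rw [notMem_support_iff.mp h, star_zero]

noncomputable instance : StarRing R[X] where
  star_involutive P := by ext n; simp only [coeff_star, star_star]
  star_add P Q := by ext n; simp only [coeff_star, coeff_add, star_add]
  star_mul P Q := by
    ext n
    simp only [coeff_star, coeff_mul, star_sum, star_mul]
    exact Finset.sum_equiv (Equiv.prodComm ℕ ℕ)
      (by simp [add_comm]) (by simp)

theorem star_C (a : R) : star (C a : R[X]) = C (star a) := by
  ext n
  rw [coeff_star, coeff_C, coeff_C, apply_ite star, star_zero]

theorem star_X : star (X : R[X]) = X := by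
  ext n
  rw [coeff_star, coeff_X, apply_ite star, star_one, star_zero]

theorem natDegree_star (P : R[X]) : (star P).natDegree = P.natDegree :=
  eq_of_forall_ge_iff fun n => by
    simp only [natDegree_le_iff_coeff_eq_zero, coeff_star, star_eq_zero]

end StarRing

section DualNumber

variable {R : Type*} [Semiring R] [StarRing R]

/-- Conjugation of dual numbers, `p + ε q ↦ p̄ + ε q̄`. -/
instance : StarRing R[ε] where
  star z := .inl (star z.fst) + .inr (star z.snd)
  star_involutive z := by ext <;> simp
  star_add z w := by ext <;> simp
  star_mul z w := by ext <;> simp [add_comm]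

theorem fst_star (z : R[ε]) : (star z).fst = star z.fst := by
  simp [star]

theorem snd_star (z : R[ε]) : (star z).snd = star z.snd := by
  simp [star]

end DualNumber

/-- The identification of dual numbers `P + ε Q` over `ℍ[t]` with polynomials over the dual
quaternions. -/
noncomputable def ofParts : ℍ[ℝ][X][ε] →ₐ[ℝ[X]] DualQuat[X] :=
  DualNumber.lift ⟨({ mapRingHom (TrivSqZeroExt.inlHom ℍ[ℝ] ℍ[ℝ]) with
      commutes' D := map_map _ _ D }, C ε),
    by rw [← C_mul, DualNumber.eps_mul_eps, C_0],
    fun P => by ext n <;> simp⟩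

theorem coeff_ofParts (z : ℍ[ℝ][X][ε]) (n : ℕ) :
    (ofParts z).coeff n = .inl (z.fst.coeff n) + .inr (z.snd.coeff n) := by
  change (z.fst.map _ + z.snd.map _ * C ε).coeff n = _
  rw [coeff_add, coeff_mul_C, coeff_map, coeff_map]
  apply TrivSqZeroExt.ext <;> simp

theorem ofParts_injective : Function.Injective ofParts := by
  intro z w h
  have hcoeff (n : ℕ) := congrArg (coeff · n) h
  simp only [coeff_ofParts] at hcoeff
  ext n : 2
  · simpa using congrArg TrivSqZeroExt.fst (hcoeff n)
  · simpa using congrArg TrivSqZeroExt.snd (hcoeff n)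

theorem ofParts_surjective : Function.Surjective ofParts := fun F => by
  induction F using Polynomial.induction_on' with
  | add F G hF hG =>
    obtain ⟨z, rfl⟩ := hF
    obtain ⟨w, rfl⟩ := hG
    exact ⟨z + w, map_add ofParts z w⟩
  | monomial n a =>
    refine ⟨.inl (monomial n a.fst) + .inr (monomial n a.snd), ?_⟩
    ext m : 1
    simp only [coeff_ofParts, TrivSqZeroExt.fst_add, TrivSqZeroExt.fst_inl, TrivSqZeroExt.fst_inr,
      TrivSqZeroExt.snd_add, TrivSqZeroExt.snd_inl, TrivSqZeroExt.snd_inr, zero_add, add_zero,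
      coeff_monomial]
    split_ifs
    · exact TrivSqZeroExt.inl_fst_add_inr_snd_eq a
    · rw [TrivSqZeroExt.inl_zero, TrivSqZeroExt.inr_zero, add_zero]

theorem primalPart_ofParts (z : ℍ[ℝ][X][ε]) : primalPart (ofParts z) = z.fst := by
  ext n : 1
  simp [primalPart, coeff_ofParts]

theorem ofParts_star (z : ℍ[ℝ][X][ε]) : ofParts (star z) = star (ofParts z) := by
  ext n : 1
  simp only [coeff_star, coeff_ofParts, fst_star, snd_star]
  ext <;> simp [fst_star, snd_star]

theorem polyConj_eq_star (F : DualQuat[X]) : polyConj F = star F := rfl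

theorem ofReal_eq_algebraMap (D : ℝ[X]) : ofReal D = algebraMap ℝ[X] DualQuat[X] D := rfl

theorem star_algebraMap (D : ℝ[X]) :
    star (algebraMap ℝ[X] ℍ[ℝ][X] D) = algebraMap ℝ[X] ℍ[ℝ][X] D := by
  ext n : 1
  simp [coeff_star, Polynomial.algebraMap_def]

theorem exists_algebraMap_eq {P : ℍ[ℝ][X]} (hP : star P = P) :
    ∃ N : ℝ[X], algebraMap ℝ[X] ℍ[ℝ][X] N = P := by
  have hlifts : P ∈ lifts (algebraMap ℝ ℍ[ℝ]) := by
    refine (lifts_iff_coeff_lifts P).mpr fun n => ⟨(P.coeff n).re, ?_⟩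
    exact (Quaternion.star_eq_self.mp (by rw [← coeff_star, hP])).symm
  obtain ⟨N, hN⟩ := hlifts
  exact ⟨N, hN⟩

theorem exists_algebraMap_eq_mul_star (P : ℍ[ℝ][X]) :
    ∃ N : ℝ[X], algebraMap ℝ[X] ℍ[ℝ][X] N = P * star P :=
  exists_algebraMap_eq (by rw [star_mul, star_star])

theorem star_mul_self_eq (P : ℍ[ℝ][X]) : star P * P = P * star P := by
  obtain rfl | hP := eq_or_ne P 0
  · simp
  obtain ⟨N, hN⟩ := exists_algebraMap_eq_mul_star P
  apply mul_left_cancel₀ hP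
  rw [← mul_assoc, ← hN, Algebra.commutes]

theorem algebraMap_injective {R A : Type*} [CommSemiring R] [Semiring A] [Algebra R A]
    [FaithfulSMul R A] : Function.Injective (algebraMap R[X] A[X]) :=
  map_injective _ (FaithfulSMul.algebraMap_injective R A)

theorem ne_zero_of_algebraMap_eq_mul_star {P : ℍ[ℝ][X]} {N : ℝ[X]} (hP : P ≠ 0)
    (hN : algebraMap ℝ[X] ℍ[ℝ][X] N = P * star P) : N ≠ 0 := by
  rintro rfl
  rw [map_zero] at hN
  exact mul_ne_zero hP (star_ne_zero.mpr hP) hN.symm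

theorem natDegree_algebraMap {R A : Type*} [CommSemiring R] [Semiring A] [Algebra R A]
    [FaithfulSMul R A] (D : R[X]) : (algebraMap R[X] A[X] D).natDegree = D.natDegree :=
  natDegree_map_eq_of_injective (FaithfulSMul.algebraMap_injective R A) D

theorem natDegree_eq_of_algebraMap_eq_mul_star {P : ℍ[ℝ][X]} {N : ℝ[X]}
    (hN : algebraMap ℝ[X] ℍ[ℝ][X] N = P * star P) : N.natDegree = 2 * P.natDegree := by
  obtain rfl | hP := eq_or_ne P 0
  · rw [← natDegree_algebraMap (A := ℍ[ℝ]), hN, zero_mul, natDegree_zero]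
  · rw [← natDegree_algebraMap (A := ℍ[ℝ]), hN, natDegree_mul hP (star_ne_zero.mpr hP),
      natDegree_star, two_mul]

theorem isMotionPolynomial_iff {F : DualQuat[X]} : IsMotionPolynomial F ↔ ∃ N : ℝ[X], N ≠ 0 ∧
    F * star F = algebraMap ℝ[X] DualQuat[X] N ∧ star F * F = algebraMap ℝ[X] DualQuat[X] N := by
  constructor
  · rintro ⟨⟨N, hN, hN'⟩, hne⟩
    exact ⟨N, fun h0 => hne (by rw [hN, h0, ofReal_eq_algebraMap, map_zero]), hN, hN'⟩
  · rintro ⟨N, hne, hN, hN'⟩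
    refine ⟨⟨N, hN, hN'⟩, ?_⟩
    rw [normPoly, polyConj_eq_star, hN]
    exact (map_ne_zero_iff _ algebraMap_injective).mpr hne

protected theorem IsMotionPolynomial.star {F : DualQuat[X]} (hF : IsMotionPolynomial F) :
    IsMotionPolynomial (star F) := by
  obtain ⟨N, hne, hN, hN'⟩ := isMotionPolynomial_iff.mp hF
  exact isMotionPolynomial_iff.mpr ⟨N, hne, by rwa [star_star], by rwa [star_star]⟩

protected theorem IsMotionPolynomial.mul {F G : DualQuat[X]} (hF : IsMotionPolynomial F)
    (hG : IsMotionPolynomial G) : IsMotionPolynomial (F * G) := by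
  obtain ⟨N, hNne, hN, hN'⟩ := isMotionPolynomial_iff.mp hF
  obtain ⟨M, hMne, hM, hM'⟩ := isMotionPolynomial_iff.mp hG
  refine isMotionPolynomial_iff.mpr ⟨N * M, mul_ne_zero hNne hMne, ?_, ?_⟩
  · calc F * G * star (F * G) = F * (G * star G) * star F := by
          simp only [star_mul, mul_assoc]
      _ = _ := by rw [hM, ← Algebra.commutes, mul_assoc, hN, ← map_mul, mul_comm]
  · calc star (F * G) * (F * G) = star G * (star F * F) * G := by
          simp only [star_mul, mul_assoc]
      _ = _ := by rw [hN', ← Algebra.commutes, mul_assoc, hM', ← map_mul]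

theorem star_mul_add_star_mul_eq_zero {P Q : ℍ[ℝ][X]} (hP : P ≠ 0)
    (h : P * star Q + Q * star P = 0) : star P * Q + star Q * P = 0 := by
  obtain ⟨N, hN⟩ := exists_algebraMap_eq_mul_star P
  apply mul_left_cancel₀ hP
  calc P * (star P * Q + star Q * P)
      = P * star P * Q - Q * (star P * P) + (P * star Q + Q * star P) * P := by noncomm_ring
    _ = P * 0 := by rw [star_mul_self_eq, ← hN, Algebra.commutes, h, sub_self]; simp

theorem isMotionPolynomial_ofParts_iff {z : ℍ[ℝ][X][ε]} : IsMotionPolynomial (ofParts z) ↔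
    z.fst ≠ 0 ∧ z.fst * star z.snd + z.snd * star z.fst = 0 := by
  simp only [isMotionPolynomial_iff, ← ofParts_star, ← map_mul, ← AlgHom.commutes ofParts,
    ofParts_injective.eq_iff, TrivSqZeroExt.algebraMap_eq_inl', TrivSqZeroExt.ext_iff,
    TrivSqZeroExt.fst_mul, DualNumber.snd_mul, fst_star, snd_star, TrivSqZeroExt.fst_inl,
    TrivSqZeroExt.snd_inl]
  constructor
  · rintro ⟨N, hne, ⟨hN, hdual⟩, -⟩
    refine ⟨fun h0 => hne (algebraMap_injective (A := ℍ[ℝ]) ?_), hdual⟩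
    rw [← hN, h0, zero_mul, map_zero]
  · rintro ⟨hP, hdual⟩
    obtain ⟨N, hN⟩ := exists_algebraMap_eq_mul_star z.fst
    exact ⟨N, ne_zero_of_algebraMap_eq_mul_star hP hN, ⟨hN.symm, hdual⟩,
      by rw [star_mul_self_eq, hN], star_mul_add_star_mul_eq_zero hP hdual⟩

theorem IsMotionPolynomial.primalPart_ne_zero {F : DualQuat[X]} (hF : IsMotionPolynomial F) :
    primalPart F ≠ 0 := by
  obtain ⟨z, rfl⟩ := ofParts_surjective F
  rw [primalPart_ofParts]
  exact (isMotionPolynomial_ofParts_iff.mp hF).1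

theorem isMotionPolynomial_ofParts_inl {P : ℍ[ℝ][X]} (hP : P ≠ 0) :
    IsMotionPolynomial (ofParts (.inl P)) := by
  simpa [isMotionPolynomial_ofParts_iff] using hP

theorem ofParts_inl_algebraMap (D : ℝ[X]) :
    ofParts (.inl (algebraMap ℝ[X] ℍ[ℝ][X] D)) = ofReal D :=
  AlgHom.commutes ofParts D

theorem isMotionPolynomial_ofReal {D : ℝ[X]} (hD : D ≠ 0) : IsMotionPolynomial (ofReal D) := by
  rw [← ofParts_inl_algebraMap]
  exact isMotionPolynomial_ofParts_inl ((map_ne_zero_iff _ algebraMap_injective).mpr hD)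

theorem IsMotionPolynomial.exists_inverse_of_C {c : DualQuat} (hc : IsMotionPolynomial (C c)) :
    ∃ c' : DualQuat, IsMotionPolynomial (C c') ∧ c * c' = 1 ∧ c' * c = 1 := by
  obtain ⟨N, hne, hN, hN'⟩ := isMotionPolynomial_iff.mp hc
  set r := N.coeff 0 with hr_def
  have hr : c * star c = algebraMap ℝ DualQuat r := by
    rw [star_C, ← C_mul] at hN
    simpa only [coeff_C_zero, algebraMap_def, coe_mapRingHom, coeff_map] using
      congrArg (coeff · 0) hN
  have hr' : star c * c = algebraMap ℝ DualQuat r := by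
    rw [star_C, ← C_mul] at hN'
    simpa only [coeff_C_zero, algebraMap_def, coe_mapRingHom, coeff_map] using
      congrArg (coeff · 0) hN'
  have hr0 : r ≠ 0 := fun h0 => hne <| algebraMap_injective (A := DualQuat) <| by
    rw [← hN, star_C, ← C_mul, hr, h0, map_zero, C_0, map_zero]
  refine ⟨algebraMap ℝ DualQuat r⁻¹ * star c, ?_, ?_, ?_⟩
  · have hmul := (isMotionPolynomial_ofReal (C_ne_zero.mpr (inv_ne_zero hr0))).mul hc.star
    rwa [ofReal, map_C, star_C, ← C_mul] at hmul
  · rw [← mul_assoc, ← Algebra.commutes, mul_assoc, hr, ← map_mul, inv_mul_cancel₀ hr0, map_one]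
  · rw [mul_assoc, hr', ← map_mul, inv_mul_cancel₀ hr0, map_one]

theorem exists_X_sub_C_mul_C_eq {x c : DualQuat} (hx : IsMotionPolynomial (X - C x))
    (hc : IsMotionPolynomial (C c)) :
    ∃ y, IsMotionPolynomial (X - C y) ∧ (X - C x) * C c = C c * (X - C y) := by
  obtain ⟨c', hc', hmul, hmul'⟩ := hc.exists_inverse_of_C
  have hconj : X - C (c' * x * c) = C c' * (X - C x) * C c := by
    rw [mul_sub, sub_mul, ← X_mul_C, mul_assoc X, ← C_mul, ← C_mul, ← C_mul, hmul', C_1, mul_one]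
  refine ⟨c' * x * c, hconj ▸ (hc'.mul hx).mul hc, ?_⟩
  rw [hconj, ← mul_assoc, ← mul_assoc, ← C_mul, hmul, C_1, one_mul]

theorem exists_list_prod_mul_C_eq {c : DualQuat} (hc : IsMotionPolynomial (C c))
    (l : List DualQuat) (hl : ∀ x ∈ l, IsMotionPolynomial (X - C x)) :
    ∃ l' : List DualQuat, (∀ x ∈ l', IsMotionPolynomial (X - C x)) ∧
      (l.map fun x => X - C x).prod * C c = C c * (l'.map fun x => X - C x).prod := by
  induction l with
  | nil => exact ⟨[], by simp, by simp⟩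
  | cons x l ih =>
    rw [List.forall_mem_cons] at hl
    obtain ⟨l', hl', hprod⟩ := ih hl.2
    obtain ⟨y, hy, hxy⟩ := exists_X_sub_C_mul_C_eq hl.1 hc
    refine ⟨y :: l', List.forall_mem_cons.mpr ⟨hy, hl'⟩, ?_⟩
    rw [List.map_cons, List.prod_cons, mul_assoc, hprod, ← mul_assoc, hxy, mul_assoc,
      List.map_cons, List.prod_cons]

theorem isMotionPolynomial_one : IsMotionPolynomial 1 := by
  simpa [ofReal] using isMotionPolynomial_ofReal one_ne_zero

/-- The products `c (t - h₁) ⋯ (t - hₙ)` of motion polynomials, `n = 0` allowed. -/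
def factorizable : Submonoid DualQuat[X] where
  carrier := {F | ∃ c : DualQuat, IsMotionPolynomial (C c) ∧ ∃ l : List DualQuat,
    (∀ x ∈ l, IsMotionPolynomial (X - C x)) ∧ F = C c * (l.map fun x => X - C x).prod}
  one_mem' := ⟨1, by simpa only [C_1] using isMotionPolynomial_one, [], by simp, by simp⟩
  mul_mem' := by
    rintro _ _ ⟨c, hc, l, hl, rfl⟩ ⟨d, hd, m, hm, rfl⟩
    obtain ⟨l', hl', hprod⟩ := exists_list_prod_mul_C_eq hd l hl
    refine ⟨c * d, by simpa only [C_mul] using hc.mul hd, l' ++ m,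
      List.forall_mem_append.mpr ⟨hl', hm⟩, ?_⟩
    rw [List.map_append, List.prod_append, C_mul, mul_assoc, ← mul_assoc _ (C d), hprod]
    simp only [mul_assoc]

theorem C_mem_factorizable {c : DualQuat} (hc : IsMotionPolynomial (C c)) :
    C c ∈ factorizable :=
  ⟨c, hc, [], by simp, by simp⟩

theorem X_sub_C_mem_factorizable {x : DualQuat} (hx : IsMotionPolynomial (X - C x)) :
    X - C x ∈ factorizable :=
  ⟨1, by simpa only [C_1] using isMotionPolynomial_one, [x], by simpa using hx, by simp⟩

-- A nonzero remainder `r` of `P` modulo `X - C z` carries the left factor over to `Q`, conjugated.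
theorem X_sub_C_dvd_or_of_dvd_mul {D : Type*} [DivisionRing D] {z : D} {P Q : D[X]}
    (h : X - C z ∣ P * Q) :
    X - C z ∣ P ∨ ∃ y, y ≠ 0 ∧ X - C (y⁻¹ * z * y) ∣ Q := by
  obtain ⟨r, hr⟩ : ∃ r, P %ₘ (X - C z) = C r := by
    have hdeg := degree_modByMonic_lt P (monic_X_sub_C z)
    rw [degree_X_sub_C, Nat.WithBot.lt_one_iff_le_zero] at hdeg
    exact ⟨_, eq_C_of_degree_le_zero hdeg⟩
  have hdiv : P = C r + (X - C z) * (P /ₘ (X - C z)) := by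
    rw [← hr, modByMonic_add_div P]
  obtain rfl | hr0 := eq_or_ne r 0
  · exact .inl ⟨_, by rwa [C_0, zero_add] at hdiv⟩
  have hconj : C r⁻¹ * (X - C z) = (X - C (r⁻¹ * z * r)) * C r⁻¹ := by
    rw [mul_sub, sub_mul, ← X_mul_C, ← C_mul, ← C_mul, mul_inv_cancel_right₀ hr0]
  obtain ⟨G, hG⟩ := h
  have hrQ : C r * Q = (X - C z) * (G - P /ₘ (X - C z) * Q) := by
    rw [mul_sub, ← hG, ← mul_assoc, ← sub_mul, ← eq_sub_iff_add_eq.mpr hdiv.symm]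
  refine .inr ⟨r, hr0, C r⁻¹ * (G - P /ₘ (X - C z) * Q), ?_⟩
  rw [← mul_assoc, ← hconj, mul_assoc, ← hrQ, ← mul_assoc, ← C_mul, inv_mul_cancel₀ hr0, C_1,
    one_mul]

theorem exists_X_sub_C_dvd_mul_star {P : ℍ[ℝ][X]} (hP : P.natDegree ≠ 0) :
    ∃ z : ℍ[ℝ], X - C z ∣ P * star P := by
  obtain ⟨N, hN⟩ := exists_algebraMap_eq_mul_star P
  have hdeg := natDegree_eq_of_algebraMap_eq_mul_star hN
  obtain ⟨z, hz⟩ := IsAlgClosed.exists_aeval_eq_zero ℂ N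
    (natDegree_pos_iff_degree_pos.mp (by omega)).ne'
  obtain ⟨G, hG⟩ := dvd_iff_isRoot.mpr (show (N.map (algebraMap ℝ ℂ)).IsRoot z by
    rwa [IsRoot, eval_map_algebraMap])
  refine ⟨Quaternion.ofComplex z, G.map (Quaternion.ofComplex : ℂ →+* ℍ[ℝ]), ?_⟩
  have := congrArg (Polynomial.map (Quaternion.ofComplex : ℂ →+* ℍ[ℝ])) hG
  rw [map_map, AlgHom.comp_algebraMap, Polynomial.map_mul] at this
  rw [← hN, Polynomial.algebraMap_def, coe_mapRingHom, this]
  simp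

theorem star_X_sub_C {R : Type*} [Ring R] [StarRing R] (a : R) :
    star (X - C a) = X - C (star a) := by
  rw [star_sub, star_X, star_C]

theorem exists_linear_factor {P : ℍ[ℝ][X]} (hP : P.natDegree ≠ 0) :
    ∃ (z : ℍ[ℝ]) (G : ℍ[ℝ][X]), P = (X - C z) * G ∨ P = G * (X - C z) := by
  obtain ⟨z, hz⟩ := exists_X_sub_C_dvd_mul_star hP
  obtain ⟨G, hG⟩ | ⟨y, -, G, hG⟩ := X_sub_C_dvd_or_of_dvd_mul hz
  · exact ⟨z, G, .inl hG⟩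
  · refine ⟨star (y⁻¹ * z * y), star G, .inr ?_⟩
    rw [← star_X_sub_C, ← star_mul, ← hG, star_star]

theorem ofParts_inl (P : ℍ[ℝ][X]) :
    ofParts (.inl P) = P.map (TrivSqZeroExt.inlHom ℍ[ℝ] ℍ[ℝ]) := by
  ext n : 1
  rw [coeff_ofParts, coeff_map, TrivSqZeroExt.fst_inl, TrivSqZeroExt.snd_inl, coeff_zero,
    TrivSqZeroExt.inr_zero, add_zero, TrivSqZeroExt.inlHom_apply]

theorem ofParts_inl_mem_factorizable {P : ℍ[ℝ][X]} (hP : P ≠ 0) :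
    ofParts (.inl P) ∈ factorizable := by
  have linear_mem (z : ℍ[ℝ]) : ofParts (.inl (X - C z)) ∈ factorizable := by
    have hmotion := isMotionPolynomial_ofParts_inl (X_sub_C_ne_zero z)
    rw [ofParts_inl, Polynomial.map_sub, map_X, map_C] at hmotion ⊢
    exact X_sub_C_mem_factorizable hmotion
  induction hn : P.natDegree generalizing P with
  | zero =>
    have hmotion := isMotionPolynomial_ofParts_inl hP
    rw [eq_C_of_natDegree_eq_zero hn, ofParts_inl, map_C] at hmotion ⊢
    exact C_mem_factorizable hmotion
  | succ n ih =>
    obtain ⟨z, G, rfl | rfl⟩ := exists_linear_factor (P := P) (by omega)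
    · have hG := right_ne_zero_of_mul hP
      rw [natDegree_mul (X_sub_C_ne_zero z) hG, natDegree_X_sub_C] at hn
      rw [TrivSqZeroExt.inl_mul, map_mul]
      exact mul_mem (linear_mem z) (ih hG (by omega))
    · have hG := left_ne_zero_of_mul hP
      rw [natDegree_mul hG (X_sub_C_ne_zero z), natDegree_X_sub_C] at hn
      rw [TrivSqZeroExt.inl_mul, map_mul]
      exact mul_mem (ih hG (by omega)) (linear_mem z)

theorem ofReal_mem_factorizable {D : ℝ[X]} (hD : D ≠ 0) : ofReal D ∈ factorizable := by
  rw [← ofParts_inl_algebraMap]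
  exact ofParts_inl_mem_factorizable ((map_ne_zero_iff _ algebraMap_injective).mpr hD)

/-- The polynomials that become a product of linear motion polynomials, up to a constant motion
polynomial, after multiplication with a nonzero real polynomial. -/
def factorizableUpToReal : Submonoid DualQuat[X] where
  carrier := {F | ∃ D : ℝ[X], D ≠ 0 ∧ F * ofReal D ∈ factorizable}
  one_mem' := ⟨1, one_ne_zero, by rw [one_mul]; exact ofReal_mem_factorizable one_ne_zero⟩
  mul_mem' := by
    rintro F G ⟨D, hD, hF⟩ ⟨E, hE, hG⟩
    refine ⟨D * E, mul_ne_zero hD hE, ?_⟩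
    have hcomm : F * G * ofReal (D * E) = F * ofReal D * (G * ofReal E) := by
      simp only [ofReal_eq_algebraMap, map_mul, mul_assoc]
      rw [← mul_assoc (algebraMap _ _ D) G, Algebra.commutes D G, mul_assoc]
    exact hcomm ▸ mul_mem hF hG

theorem mem_factorizableUpToReal_of_mem {F : DualQuat[X]} (hF : F ∈ factorizable) :
    F ∈ factorizableUpToReal :=
  ⟨1, one_ne_zero, by rwa [ofReal_eq_algebraMap, map_one, mul_one]⟩

theorem mem_factorizableUpToReal_of_mul_ofReal {F : DualQuat[X]} {B : ℝ[X]} (hB : B ≠ 0)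
    (hF : F * ofReal B ∈ factorizableUpToReal) : F ∈ factorizableUpToReal := by
  obtain ⟨D, hD, hFD⟩ := hF
  refine ⟨B * D, mul_ne_zero hB hD, ?_⟩
  rwa [ofReal_eq_algebraMap, map_mul, ← mul_assoc]

/-- The polynomial `A + ε V`; for `V̄ = -V` it describes a translational motion, with translation
vector proportional to `V / A`. -/
noncomputable def translation (A : ℝ[X]) (V : ℍ[ℝ][X]) : DualQuat[X] :=
  ofParts (.inl (algebraMap ℝ[X] ℍ[ℝ][X] A) + .inr V)

theorem translation_mul (A B : ℝ[X]) (V W : ℍ[ℝ][X]) :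
    translation A V * translation B W = translation (A * B) (A • W + B • V) := by
  rw [translation, translation, translation, ← map_mul]
  congr 1
  apply TrivSqZeroExt.ext
  · simp
  · simp only [DualNumber.snd_mul, TrivSqZeroExt.fst_add, TrivSqZeroExt.fst_inl,
      TrivSqZeroExt.fst_inr, TrivSqZeroExt.snd_add, TrivSqZeroExt.snd_inl, TrivSqZeroExt.snd_inr,
      add_zero, zero_add, Algebra.smul_def, Algebra.commutes B]

theorem translation_zero (A : ℝ[X]) : translation A 0 = ofReal A := by
  rw [translation, TrivSqZeroExt.inr_zero, add_zero, ofParts_inl_algebraMap]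

theorem translation_mul_ofReal (A B : ℝ[X]) (V : ℍ[ℝ][X]) :
    translation A V * ofReal B = translation (A * B) (B • V) := by
  rw [← translation_zero, translation_mul, smul_zero, zero_add]

theorem ofParts_inl_mul_translation_mul {P : ℍ[ℝ][X]} {N : ℝ[X]}
    (hN : P * star P = algebraMap ℝ[X] ℍ[ℝ][X] N) (A : ℝ[X]) (V : ℍ[ℝ][X]) :
    ofParts (.inl P) * translation A V * ofParts (.inl (star P)) =
      translation (N * A) (P * V * star P) := by
  rw [translation, translation, ← map_mul, ← map_mul]
  congr 1
  apply TrivSqZeroExt.ext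
  · simp only [TrivSqZeroExt.fst_mul, TrivSqZeroExt.fst_add, TrivSqZeroExt.fst_inl,
      TrivSqZeroExt.fst_inr, add_zero, map_mul, ← hN]
    rw [mul_assoc, Algebra.commutes, mul_assoc]
  · simp

/-- The translation `A + ε V` factors into linear motion polynomials, up to a real factor. -/
def TranslationFactors (A : ℝ[X]) (V : ℍ[ℝ][X]) : Prop :=
  translation A V ∈ factorizableUpToReal

namespace TranslationFactors

variable {A B : ℝ[X]} {V W : ℍ[ℝ][X]}

protected theorem mul (hV : TranslationFactors A V) (hW : TranslationFactors B W) :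
    TranslationFactors (A * B) (A • W + B • V) := by
  rw [TranslationFactors, ← translation_mul]
  exact mul_mem hV hW

theorem mul_smul_iff (hB : B ≠ 0) :
    TranslationFactors (A * B) (B • V) ↔ TranslationFactors A V := by
  rw [TranslationFactors, ← translation_mul_ofReal]
  exact ⟨mem_factorizableUpToReal_of_mul_ofReal hB, fun hV =>
    mul_mem hV (mem_factorizableUpToReal_of_mem (ofReal_mem_factorizable hB))⟩

protected theorem add (hA : A ≠ 0) (hV : TranslationFactors A V) (hW : TranslationFactors A W) :
    TranslationFactors A (V + W) := by
  rw [← mul_smul_iff hA, smul_add, add_comm]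
  exact hV.mul hW

theorem conj (hV : TranslationFactors A V) {P : ℍ[ℝ][X]} {N : ℝ[X]} (hN0 : N ≠ 0)
    (hN : P * star P = algebraMap ℝ[X] ℍ[ℝ][X] N) :
    TranslationFactors (N * A) (P * V * star P) := by
  have hP : P ≠ 0 := by
    rintro rfl
    rw [zero_mul] at hN
    exact hN0 (algebraMap_injective (A := ℍ[ℝ]) (by rw [← hN, map_zero]))
  rw [TranslationFactors, ← ofParts_inl_mul_translation_mul hN]
  exact mul_mem (mul_mem (mem_factorizableUpToReal_of_mem (ofParts_inl_mem_factorizable hP)) hV)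
    (mem_factorizableUpToReal_of_mem (ofParts_inl_mem_factorizable (star_ne_zero.mpr hP)))

end TranslationFactors

theorem exists_sq_eq_neg_one_anticommuting {u : ℍ[ℝ]} (hu : star u = -u) :
    ∃ n : ℍ[ℝ], star n = -n ∧ n * n = -1 ∧ n * u = -(u * n) := by
  obtain ⟨w, hw0, hw, hwu⟩ : ∃ w : ℍ[ℝ], w ≠ 0 ∧ w.re = 0 ∧ (w * u).re = 0 := by
    let re : ℍ[ℝ] →ₗ[ℝ] ℝ := QuaternionAlgebra.reₗ (-1) 0 (-1)
    have hker := LinearMap.ker_ne_bot_of_finrank_lt (f := re.prod (re ∘ₗ LinearMap.mulRight ℝ u))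
      (by simp [Quaternion.finrank_eq_four])
    obtain ⟨w, hw, hw0⟩ := (Submodule.ne_bot_iff _).mp hker
    rw [LinearMap.mem_ker] at hw
    exact ⟨w, hw0, congrArg Prod.fst hw, congrArg Prod.snd hw⟩
  have hstar : star w = -w := Quaternion.star_eq_neg.mpr hw
  have hanti : w * u = -(u * w) := by
    have h := Quaternion.star_eq_neg.mpr hwu
    rw [star_mul, hu, hstar, neg_mul_neg] at h
    rw [h, neg_neg]
  have hsq : w * w = -((‖w‖ * ‖w‖ : ℝ) : ℍ[ℝ]) := by
    rw [← Quaternion.normSq_eq_norm_mul_self, ← Quaternion.self_mul_star, hstar, mul_neg, neg_neg]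
  have hnorm := norm_ne_zero_iff.mpr hw0
  refine ⟨‖w‖⁻¹ • w, by rw [Quaternion.star_smul, hstar, smul_neg], ?_,
    by rw [smul_mul_assoc, hanti, mul_smul_comm, smul_neg]⟩
  rw [smul_mul_smul_comm, hsq, smul_neg, Quaternion.smul_coe, mul_mul_mul_comm,
    inv_mul_cancel₀ hnorm, one_mul, Quaternion.coe_one]

section Rotation

variable {A s q : ℝ[X]} {n u : ℍ[ℝ]}

theorem star_algebraMap_sub_smul_C (hn : star n = -n) :
    star (algebraMap ℝ[X] ℍ[ℝ][X] s - q • C n) = algebraMap ℝ[X] ℍ[ℝ][X] s + q • C n := by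
  rw [star_sub, star_algebraMap, Algebra.smul_def, star_mul, star_algebraMap, star_C, hn, C_neg,
    neg_mul, sub_neg_eq_add, Algebra.commutes]

theorem algebraMap_sub_smul_C_mul_star (hn : star n = -n) (hsq : n * n = -1) :
    (algebraMap ℝ[X] ℍ[ℝ][X] s - q • C n) * star (algebraMap ℝ[X] ℍ[ℝ][X] s - q • C n) =
      algebraMap ℝ[X] ℍ[ℝ][X] (s ^ 2 + q ^ 2) := by
  rw [star_algebraMap_sub_smul_C hn, Algebra.algebraMap_eq_smul_one, Algebra.algebraMap_eq_smul_one]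
  simp only [mul_add, sub_mul, smul_mul_smul_comm, ← C_mul, hsq, mul_one, one_mul, C_neg, C_1]
  module

theorem algebraMap_sub_smul_C_conj (hn : star n = -n) (hsq : n * n = -1) (hnu : n * u = -(u * n)) :
    (algebraMap ℝ[X] ℍ[ℝ][X] s - q • C n) * C u * star (algebraMap ℝ[X] ℍ[ℝ][X] s - q • C n) =
      (s ^ 2 - q ^ 2) • C u - (2 * (s * q)) • C (n * u) := by
  have hun : u * n = -(n * u) := by rw [hnu, neg_neg]
  have hnun : n * u * n = u := by
    rw [mul_assoc, hun, mul_neg, ← mul_assoc, hsq, neg_one_mul, neg_neg]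
  rw [star_algebraMap_sub_smul_C hn, Algebra.algebraMap_eq_smul_one]
  simp only [mul_add, sub_mul, smul_mul_assoc, mul_smul_comm, ← C_mul, hun, hnun, mul_one, one_mul,
    C_neg]
  module


theorem TranslationFactors.rotate (hN : s ^ 2 + q ^ 2 ≠ 0) (hn : star n = -n) (hsq : n * n = -1)
    (hnu : n * u = -(u * n)) (h : TranslationFactors A (C u)) :
    TranslationFactors ((s ^ 2 + q ^ 2) * A)
      ((s ^ 2 - q ^ 2) • C u - (2 * (s * q)) • C (n * u)) := by
  rw [← algebraMap_sub_smul_C_conj hn hsq hnu]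
  exact h.conj hN (algebraMap_sub_smul_C_mul_star hn hsq)

theorem TranslationFactors.rotate_neg (hN : s ^ 2 + q ^ 2 ≠ 0) (hn : star n = -n)
    (hsq : n * n = -1) (hnu : n * u = -(u * n)) (h : TranslationFactors A (C u)) :
    TranslationFactors ((s ^ 2 + q ^ 2) * A)
      ((s ^ 2 - q ^ 2) • C u + (2 * (s * q)) • C (n * u)) := by
  have hrot := h.rotate hN (n := -n) (by rw [star_neg, hn]) (by rw [neg_mul_neg, hsq])
    (by rw [neg_mul, mul_neg, hnu])
  rwa [neg_mul, C_neg, smul_neg, sub_neg_eq_add] at hrot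

-- The rotations of `-u` by opposite angles add up to `-2 (s ^ 2 - q ^ 2) u`; now add
-- `2 (s ^ 2 + q ^ 2) u`.
theorem TranslationFactors.sq_smul_of_forall (hA : A ≠ 0) (hN : s ^ 2 + q ^ 2 ≠ 0)
    (h : ∀ u : ℍ[ℝ], star u = -u → TranslationFactors A (C u)) (hu : star u = -u) :
    TranslationFactors ((s ^ 2 + q ^ 2) * A) ((4 * q ^ 2) • C u) := by
  obtain ⟨n, hn, hsq, hnu⟩ := exists_sq_eq_neg_one_anticommuting hu
  have hu' : star (-u) = - -u := by rw [star_neg, hu]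
  have hnu' : n * -u = -(-u * n) := by rw [mul_neg, hnu, neg_mul]
  have hscaled := (TranslationFactors.mul_smul_iff hN).mpr (h u hu)
  rw [mul_comm A] at hscaled
  have hNA := mul_ne_zero hN hA
  convert ((hscaled.add hNA hscaled).add hNA ((h _ hu').rotate hN hn hsq hnu')).add hNA
    ((h _ hu').rotate_neg hN hn hsq hnu') using 1
  rw [C_neg]
  module

-- The same with `n u` and `-n u`, rotated by opposite angles: only the sine terms survive.
theorem TranslationFactors.mul_smul_of_forall (hA : A ≠ 0) (hN : s ^ 2 + q ^ 2 ≠ 0)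
    (h : ∀ u : ℍ[ℝ], star u = -u → TranslationFactors A (C u)) (hu : star u = -u) :
    TranslationFactors ((s ^ 2 + q ^ 2) * A) ((4 * (s * q)) • C u) := by
  obtain ⟨n, hn, hsq, hnu⟩ := exists_sq_eq_neg_one_anticommuting hu
  have hw : star (n * u) = -(n * u) := by rw [star_mul, hu, hn, neg_mul_neg, hnu, neg_neg]
  have hw' : star (-(n * u)) = - -(n * u) := by rw [star_neg, hw]
  have hnn : n * (n * u) = -u := by rw [← mul_assoc, hsq, neg_one_mul]
  have hnw : n * (n * u) = -(n * u * n) := by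
    rw [hnn, hnu, neg_mul, mul_assoc, hsq, mul_neg_one, neg_neg]
  convert ((h _ hw).rotate hN hn hsq hnw).add (mul_ne_zero hN hA)
    ((h _ hw').rotate_neg hN hn hsq (by rw [mul_neg, hnw, neg_mul])) using 1
  rw [mul_neg, hnn, neg_neg]
  simp only [C_neg]
  module

end Rotation

theorem C_smul_C {R A : Type*} [CommSemiring R] [Semiring A] [Algebra R A] (r : R) (u : A) :
    (C r : R[X]) • (C u : A[X]) = C (r • u) := by
  rw [Algebra.smul_def, Polynomial.algebraMap_def, coe_mapRingHom, map_C, ← C_mul,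
    ← Algebra.smul_def]

/-- Every translation along a fixed direction `e` with fraction `f / A`, `deg f ≤ deg A`, factors
up to a real polynomial. By additivity this covers all translations `A + ε V` with
`deg V ≤ deg A`. -/
def AllTranslationsFactor (A : ℝ[X]) : Prop :=
  ∀ f : ℝ[X], f.natDegree ≤ A.natDegree → ∀ e : ℍ[ℝ], star e = -e →
    TranslationFactors A (f • C e)

theorem star_smul_eq_neg {e : ℍ[ℝ]} (he : star e = -e) (r : ℝ) : star (r • e) = -(r • e) := by
  rw [Quaternion.star_smul, he, smul_neg]

theorem isMotionPolynomial_translation {A : ℝ[X]} {V : ℍ[ℝ][X]} (hA : A ≠ 0) (hV : star V = -V) :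
    IsMotionPolynomial (translation A V) := by
  rw [translation, isMotionPolynomial_ofParts_iff]
  simp only [TrivSqZeroExt.fst_add, TrivSqZeroExt.fst_inl, TrivSqZeroExt.fst_inr,
    TrivSqZeroExt.snd_add, TrivSqZeroExt.snd_inl, TrivSqZeroExt.snd_inr, add_zero, zero_add]
  refine ⟨(map_ne_zero_iff _ algebraMap_injective).mpr hA, ?_⟩
  rw [hV, star_algebraMap, Algebra.commutes, neg_mul, neg_add_cancel]

theorem translation_C (A : ℝ[X]) (u : ℍ[ℝ]) : translation A (C u) = ofReal A + C (.inr u) := by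
  rw [translation, map_add, ofParts_inl_algebraMap]
  congr 1
  ext n : 1
  rw [coeff_ofParts, TrivSqZeroExt.fst_inr, TrivSqZeroExt.snd_inr, coeff_zero,
    TrivSqZeroExt.inl_zero, zero_add, coeff_C, coeff_C]
  split_ifs
  · rfl
  · exact TrivSqZeroExt.inr_zero _

theorem translationFactors_C_C {a : ℝ} (ha : a ≠ 0) {u : ℍ[ℝ]} (hu : star u = -u) :
    TranslationFactors (C a) (C u) := by
  have hmotion := isMotionPolynomial_translation (C_ne_zero.mpr ha)
    (show star (C u) = -C u by rw [star_C, hu, C_neg])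
  rw [translation_C, ofReal, map_C, ← C_add] at hmotion
  rw [TranslationFactors, translation_C, ofReal, map_C, ← C_add]
  exact mem_factorizableUpToReal_of_mem (C_mem_factorizable hmotion)

theorem translationFactors_X_sub_C_C (a : ℝ) {u : ℍ[ℝ]} (hu : star u = -u) :
    TranslationFactors (X - C a) (C u) := by
  have hmotion := isMotionPolynomial_translation (X_sub_C_ne_zero a)
    (show star (C u) = -C u by rw [star_C, hu, C_neg])
  have hlinear : translation (X - C a) (C u) = X - C (algebraMap ℝ DualQuat a - .inr u) := by
    rw [translation_C, ofReal, Polynomial.map_sub, map_X, map_C, C_sub, sub_sub_eq_add_sub,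
      sub_add_eq_add_sub]
  rw [hlinear] at hmotion
  rw [TranslationFactors, hlinear]
  exact mem_factorizableUpToReal_of_mem (X_sub_C_mem_factorizable hmotion)

theorem allTranslationsFactor_of_degree_lt {A : ℝ[X]} (hA : A ≠ 0)
    (h : ∀ f : ℝ[X], f.degree < A.degree → ∀ e : ℍ[ℝ], star e = -e →
      TranslationFactors A (f • C e)) :
    AllTranslationsFactor A := by
  intro f hf e he
  obtain ⟨r, hr⟩ : ∃ r, f / A = C r := by
    refine ⟨_, eq_C_of_degree_le_zero ?_⟩
    obtain hlt | hle := lt_or_ge f.degree A.degree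
    · rw [(Polynomial.div_eq_zero_iff hA).mpr hlt, degree_zero]
      exact bot_le
    · refine WithBot.le_of_add_le_add_left (degree_ne_bot.mpr hA) ?_
      rw [degree_add_div hA hle, add_zero]
      exact (degree_le_of_natDegree_le hf).trans (degree_eq_natDegree hA).ge
  have hconst : TranslationFactors A (A • C (r • e)) := by
    simpa only [C_1, one_mul] using (TranslationFactors.mul_smul_iff hA).mpr
      (translationFactors_C_C one_ne_zero (star_smul_eq_neg he r))
  convert hconst.add hA (h (f % A) (degree_mod_lt f hA) e he) using 1
  rw [← C_smul_C, ← hr, smul_smul, ← add_smul, EuclideanDomain.div_add_mod]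

theorem allTranslationsFactor_one : AllTranslationsFactor 1 := by
  intro f hf e he
  rw [natDegree_one, nonpos_iff_eq_zero] at hf
  rw [eq_C_of_natDegree_eq_zero hf, C_smul_C, ← C_1]
  exact translationFactors_C_C one_ne_zero (star_smul_eq_neg he _)

theorem allTranslationsFactor_X_sub_C (a : ℝ) : AllTranslationsFactor (X - C a) := by
  refine allTranslationsFactor_of_degree_lt (X_sub_C_ne_zero a) fun f hf e he => ?_
  rw [degree_X_sub_C, Nat.WithBot.lt_one_iff_le_zero] at hf
  rw [eq_C_of_degree_le_zero hf, C_smul_C]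
  exact translationFactors_X_sub_C_C a (star_smul_eq_neg he _)

theorem monic_sq_add_C_sq {R : Type*} [CommRing R] (a b : R) :
    ((X - C a) ^ 2 + C b ^ 2).Monic := by
  nontriviality R
  monicity!

theorem natDegree_sq_add_C_sq {R : Type*} [CommRing R] [Nontrivial R] (a b : R) :
    ((X - C a) ^ 2 + C b ^ 2).natDegree = 2 := by
  compute_degree!

theorem TranslationFactors.linear_smul_of_forall {A : ℝ[X]} (hA : A ≠ 0)
    (h : ∀ u : ℍ[ℝ], star u = -u → TranslationFactors A (C u)) (a r t : ℝ) {b : ℝ} (hb : b ≠ 0)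
    {e : ℍ[ℝ]} (he : star e = -e) :
    TranslationFactors (((X - C a) ^ 2 + C b ^ 2) * A) ((C r * (X - C a) + C t) • C e) := by
  have hM := (monic_sq_add_C_sq a b).ne_zero
  have hr : C r = 4 * C b * C (r / (4 * b)) := by
    rw [show (4 : ℝ[X]) = C 4 from rfl, ← C_mul, ← C_mul]
    field_simp
  have ht : C t = 4 * C b ^ 2 * C (t / (4 * b ^ 2)) := by
    rw [show (4 : ℝ[X]) = C 4 from rfl, ← C_pow, ← C_mul, ← C_mul]
    field_simp
  convert (TranslationFactors.mul_smul_of_forall hA hM h (star_smul_eq_neg he (r / (4 * b)))).add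
    (mul_ne_zero hM hA)
    (TranslationFactors.sq_smul_of_forall hA hM h (star_smul_eq_neg he (t / (4 * b ^ 2)))) using 1
  rw [← C_smul_C, ← C_smul_C, hr, ht]
  module

theorem AllTranslationsFactor.sq_add_C_sq_mul {A : ℝ[X]} (hA : A ≠ 0) (h : AllTranslationsFactor A)
    (a : ℝ) {b : ℝ} (hb : b ≠ 0) : AllTranslationsFactor (((X - C a) ^ 2 + C b ^ 2) * A) := by
  intro f hf e he
  have hconst (u : ℍ[ℝ]) (hu : star u = -u) : TranslationFactors A (C u) := by
    simpa only [one_smul] using h 1 (by simp) u hu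
  have hlinear (r t : ℝ) := TranslationFactors.linear_smul_of_forall hA hconst a r t hb he
  have hmonic := monic_sq_add_C_sq a b
  have hdeg := natDegree_sq_add_C_sq a b
  set M := (X - C a) ^ 2 + C b ^ 2
  rw [natDegree_mul hmonic.ne_zero hA] at hf
  have hquot : TranslationFactors (M * A) (M • (f /ₘ M) • C e) := by
    rw [mul_comm, TranslationFactors.mul_smul_iff hmonic.ne_zero]
    exact h _ (by rw [natDegree_divByMonic f hmonic]; omega) e he
  obtain ⟨r, t, hrt⟩ : ∃ r t : ℝ, f %ₘ M = C r * (X - C a) + C t := by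
    have hlt := natDegree_modByMonic_lt f hmonic fun h1 => by
      rw [h1, natDegree_one] at hdeg; omega
    obtain ⟨r, t, hrt⟩ := exists_eq_X_add_C_of_natDegree_le_one (p := f %ₘ M) (by omega)
    exact ⟨r, r * a + t, by rw [hrt, C_add, C_mul]; ring⟩
  convert hquot.add (mul_ne_zero hmonic.ne_zero hA) (hlinear r t) using 1
  rw [smul_smul, ← add_smul, ← hrt, add_comm, modByMonic_add_div]

theorem allTranslationsFactor_sq_add_C_sq_pow (a : ℝ) {b : ℝ} (hb : b ≠ 0) (k : ℕ) :
    AllTranslationsFactor (((X - C a) ^ 2 + C b ^ 2) ^ k) := by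
  induction k with
  | zero => rw [pow_zero]; exact allTranslationsFactor_one
  | succ k ih =>
    rw [pow_succ']
    exact ih.sq_add_C_sq_mul (pow_ne_zero k (monic_sq_add_C_sq a b).ne_zero) a hb

theorem AllTranslationsFactor.of_associated {A B : ℝ[X]} (hA : AllTranslationsFactor A)
    (hAB : Associated A B) : AllTranslationsFactor B := by
  obtain ⟨u, rfl⟩ := hAB
  obtain ⟨c, hc, hcu⟩ := isUnit_iff.mp u.isUnit
  rw [← hcu]
  intro f hf e he
  have hf' : f.natDegree ≤ A.natDegree := hf.trans_eq (natDegree_mul_C hc.ne_zero)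
  convert (TranslationFactors.mul_smul_iff (C_ne_zero.mpr hc.ne_zero)).mpr
    (hA f hf' _ (star_smul_eq_neg he c⁻¹)) using 1
  rw [← C_smul_C, smul_smul, smul_smul, mul_right_comm, ← C_mul,
    mul_inv_cancel₀ hc.ne_zero, C_1, one_mul]

theorem AllTranslationsFactor.mul {A B : ℝ[X]} (hA0 : A ≠ 0) (hB0 : B ≠ 0) (hAB : IsCoprime A B)
    (hA : AllTranslationsFactor A) (hB : AllTranslationsFactor B) :
    AllTranslationsFactor (A * B) := by
  obtain ⟨x, y, hxy⟩ := hAB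
  refine allTranslationsFactor_of_degree_lt (mul_ne_zero hA0 hB0) fun f hf e he => ?_
  set g := f * y % A
  have hg_lt : g.degree < A.degree := degree_mod_lt _ hA0
  obtain ⟨w, hw⟩ : A ∣ f - B * g := by
    have hdiv : A * (f * y / A) + g = f * y := EuclideanDomain.div_add_mod _ _
    exact ⟨f * x + B * (f * y / A), by linear_combination (-f) * hxy - B * hdiv⟩
  have hw_lt : w.degree < B.degree := by
    have hAw : (A * w).degree < A.degree + B.degree := by
      rw [← hw, ← degree_mul]
      refine (degree_sub_le _ _).trans_lt (max_lt hf ?_)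
      rw [degree_mul, degree_mul, add_comm]
      exact WithBot.add_lt_add_right (degree_ne_bot.mpr hB0) hg_lt
    rw [degree_mul] at hAw
    exact lt_of_add_lt_add_left hAw
  convert (hA g (natDegree_le_natDegree hg_lt.le) e he).mul
    (hB w (natDegree_le_natDegree hw_lt.le) e he) using 1
  rw [smul_smul, smul_smul, ← add_smul, ← hw, sub_add_cancel]

theorem exists_associated_of_irreducible {p : ℝ[X]} (hp : Irreducible p) :
    (∃ a : ℝ, Associated (X - C a) p) ∨
      ∃ a b : ℝ, b ≠ 0 ∧ Associated ((X - C a) ^ 2 + C b ^ 2) p := by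
  obtain ⟨z, hz⟩ := IsAlgClosed.exists_aeval_eq_zero ℂ p (degree_pos_of_irreducible hp).ne'
  obtain him | him := eq_or_ne z.im 0
  · left
    refine ⟨z.re, (irreducible_X_sub_C _).associated_of_dvd hp (dvd_iff_isRoot.mpr ?_)⟩
    have hre : z = algebraMap ℝ ℂ z.re := Complex.ext rfl him
    rw [hre, aeval_algebraMap_apply, coe_aeval_eq_eval] at hz
    exact (algebraMap ℝ ℂ).injective (by rw [hz, map_zero])
  · right
    refine ⟨z.re, z.im, him, ?_⟩
    have hdvd : (X - C z.re) ^ 2 + C z.im ^ 2 ∣ p := by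
      convert p.quadratic_dvd_of_aeval_eq_zero_im_ne_zero hz him using 1
      rw [← Complex.normSq_eq_norm_sq, Complex.normSq_apply]
      simp only [C_mul, C_add, map_ofNat]
      ring
    have hnot_unit : ¬ IsUnit ((X - C z.re) ^ 2 + C z.im ^ 2) :=
      not_isUnit_of_natDegree_pos _ (by rw [natDegree_sq_add_C_sq]; exact two_pos)
    exact ((hp.dvd_iff.mp hdvd).resolve_left hnot_unit).symm

theorem allTranslationsFactor_of_not_sq_dvd {A : ℝ[X]} (hA0 : A ≠ 0)
    (hA : ∀ a : ℝ, ¬ (X - C a) ^ 2 ∣ A) : AllTranslationsFactor A := by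
  induction A using UniqueFactorizationMonoid.induction_on_coprime with
  | h0 => exact absurd rfl hA0
  | h1 hu => exact allTranslationsFactor_one.of_associated (associated_one_iff_isUnit.mpr hu).symm
  | @hpr p i hp =>
    obtain ⟨a, hap⟩ | ⟨a, b, hb, hbp⟩ := exists_associated_of_irreducible hp.irreducible
    · have hi : i < 2 := by
        by_contra! hi
        exact hA a ((pow_dvd_pow_of_dvd hap.dvd 2).trans (pow_dvd_pow p hi))
      interval_cases i
      · rw [pow_zero]
        exact allTranslationsFactor_one
      · rw [pow_one]
        exact (allTranslationsFactor_X_sub_C a).of_associated hap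
    · exact (allTranslationsFactor_sq_add_C_sq_pow a hb i).of_associated (hbp.pow_pow)
  | @hcp x y hxy hx hy =>
    obtain ⟨hx0, hy0⟩ := mul_ne_zero_iff.mp hA0
    exact .mul hx0 hy0 hxy.isCoprime (hx hx0 fun a h => hA a (h.mul_right y))
      (hy hy0 fun a h => hA a (h.mul_left x))

theorem AllTranslationsFactor.translationFactors {A : ℝ[X]} {V : ℍ[ℝ][X]} (hA0 : A ≠ 0)
    (hA : AllTranslationsFactor A) (hV : star V = -V) (hdeg : V.natDegree ≤ A.natDegree) :
    TranslationFactors A V := by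
  have hterm (k : ℕ) (hk : k ≤ A.natDegree) :
      TranslationFactors A ((X ^ k : ℝ[X]) • C (V.coeff k)) :=
    hA _ (by rwa [natDegree_X_pow]) _ (by rw [← coeff_star, hV, coeff_neg])
  have hsum : V = ∑ k ∈ Finset.range (A.natDegree + 1), (X ^ k : ℝ[X]) • C (V.coeff k) := by
    conv_lhs => rw [V.as_sum_range' _ (Nat.lt_succ_of_le hdeg)]
    refine Finset.sum_congr rfl fun k _ => ?_
    rw [Algebra.smul_def, map_pow, Polynomial.algebraMap_def, coe_mapRingHom, map_X,
      X_pow_mul_C, C_mul_X_pow_eq_monomial]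
  rw [hsum]
  refine Finset.sum_induction _ (TranslationFactors A) (fun _ _ => .add hA0) ?_ fun k hk =>
    hterm k (Finset.mem_range_succ_iff.mp hk)
  simpa only [map_zero, smul_zero] using hA 1 (by simp) 0 (by simp)

theorem algebraMap_X_sub_C (a : ℝ) :
    algebraMap ℝ[X] ℍ[ℝ][X] (X - C a) = X - C (a : ℍ[ℝ]) := by
  rw [Polynomial.algebraMap_def, coe_mapRingHom, Polynomial.map_sub, map_X, map_C]
  rfl

theorem not_X_sub_C_dvd_of_isMaxRealFactor {P G : ℍ[ℝ][X]} {p : ℝ[X]} (hp : IsMaxRealFactor p P)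
    (hG : P = algebraMap ℝ[X] ℍ[ℝ][X] p * G) (a : ℝ) : ¬ X - C (a : ℍ[ℝ]) ∣ G := by
  rintro ⟨H, rfl⟩
  have hdeg := hp.2.2 (p * (X - C a)) ⟨H, by
    rw [hG, ← algebraMap_X_sub_C, ← mul_assoc, ← map_mul]; rfl⟩
  rw [natDegree_mul hp.1.ne_zero (X_sub_C_ne_zero a), natDegree_X_sub_C] at hdeg
  omega

theorem not_X_sub_C_dvd_of_mul_star {G : ℍ[ℝ][X]} {N : ℝ[X]}
    (hN : algebraMap ℝ[X] ℍ[ℝ][X] N = G * star G) {a : ℝ} (hG : ¬ X - C (a : ℍ[ℝ]) ∣ G) :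
    ¬ X - C a ∣ N := by
  rintro ⟨H, rfl⟩
  have hdvd : X - C (a : ℍ[ℝ]) ∣ G * star G := by
    rw [← hN, map_mul, algebraMap_X_sub_C]
    exact dvd_mul_right _ _
  obtain h | ⟨y, hy, K, hK⟩ := X_sub_C_dvd_or_of_dvd_mul hdvd
  · exact hG h
  · refine hG ⟨star K, ?_⟩
    rw [mul_assoc, Quaternion.coe_commutes, inv_mul_cancel_left₀ hy] at hK
    have hG' := congrArg star hK
    rwa [star_star, star_mul, ← algebraMap_X_sub_C, star_algebraMap, ← Algebra.commutes,
      algebraMap_X_sub_C] at hG'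

theorem ofParts_mul_ofReal_eq {z : ℍ[ℝ][X][ε]} {G : ℍ[ℝ][X]} {p N : ℝ[X]}
    (hG : z.fst = algebraMap ℝ[X] ℍ[ℝ][X] p * G)
    (hN : algebraMap ℝ[X] ℍ[ℝ][X] N = G * star G) :
    ofParts z * ofReal N = translation (p * N) (z.snd * star G) * ofParts (.inl G) := by
  rw [translation, ← ofParts_inl_algebraMap, ← map_mul, ← map_mul]
  congr 1
  apply TrivSqZeroExt.ext
  · simp only [TrivSqZeroExt.fst_mul, TrivSqZeroExt.fst_add, TrivSqZeroExt.fst_inl,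
      TrivSqZeroExt.fst_inr, add_zero, map_mul, hG]
    rw [mul_assoc, mul_assoc, Algebra.commutes N G]
  · simp only [DualNumber.snd_mul, TrivSqZeroExt.fst_add, TrivSqZeroExt.fst_inl,
      TrivSqZeroExt.fst_inr, TrivSqZeroExt.snd_add, TrivSqZeroExt.snd_inl,
      TrivSqZeroExt.snd_inr, mul_zero, zero_add]
    rw [mul_assoc, star_mul_self_eq, hN]

theorem star_mul_star_eq_neg {P Q G : ℍ[ℝ][X]} {p : ℝ[X]} (hp : p ≠ 0)
    (hG : P = algebraMap ℝ[X] ℍ[ℝ][X] p * G) (hPQ : P * star Q + Q * star P = 0) :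
    star (Q * star G) = -(Q * star G) := by
  rw [star_mul, star_star, eq_neg_iff_add_eq_zero]
  apply mul_left_cancel₀ ((map_ne_zero_iff _ (algebraMap_injective (A := ℍ[ℝ]))).mpr hp)
  rw [mul_zero, ← hPQ, hG, star_mul, star_algebraMap, ← Algebra.commutes, mul_add,
    Algebra.left_comm, mul_assoc]

theorem not_sq_dvd_mul_of_not_dvd {K : Type*} [Field K] {p N : K[X]} {a : K} (hp0 : p ≠ 0)
    (hp : p.IsRoot a → p.rootMultiplicity a = 1) (hN : ¬ X - C a ∣ N) :
    ¬ (X - C a) ^ 2 ∣ p * N := by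
  intro h
  have hcoprime : IsCoprime ((X - C a) ^ 2) N :=
    ((irreducible_X_sub_C a).coprime_iff_not_dvd.mpr hN).pow_left
  have htwo : 2 ≤ p.rootMultiplicity a :=
    (le_rootMultiplicity_iff hp0).mpr (hcoprime.dvd_of_dvd_mul_right h)
  have hone := hp ((rootMultiplicity_pos hp0).mp (by omega))
  omega

theorem mem_factorizableUpToReal {z : ℍ[ℝ][X][ε]} (hz : IsMotionPolynomial (ofParts z))
    (hdeg : z.snd.natDegree ≤ z.fst.natDegree)
    (hmult : ∀ a : ℝ, (mrpf z.fst).IsRoot a → (mrpf z.fst).rootMultiplicity a = 1) :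
    ofParts z ∈ factorizableUpToReal := by
  obtain ⟨hP, hdual⟩ := isMotionPolynomial_ofParts_iff.mp hz
  have hmax : IsMaxRealFactor (mrpf z.fst) z.fst := (mrpf_eq_iff hP).mp rfl
  set p := mrpf z.fst
  have hp : p ≠ 0 := hmax.1.ne_zero
  obtain ⟨G, hG⟩ : ∃ G, z.fst = algebraMap ℝ[X] ℍ[ℝ][X] p * G := hmax.2.1
  have hG0 : G ≠ 0 := right_ne_zero_of_mul (hG ▸ hP)
  obtain ⟨N, hN⟩ := exists_algebraMap_eq_mul_star G
  have hN0 := ne_zero_of_algebraMap_eq_mul_star hG0 hN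
  have hall : AllTranslationsFactor (p * N) :=
    allTranslationsFactor_of_not_sq_dvd (mul_ne_zero hp hN0) fun a =>
      not_sq_dvd_mul_of_not_dvd hp (hmult a) <|
        not_X_sub_C_dvd_of_mul_star hN (not_X_sub_C_dvd_of_isMaxRealFactor hmax hG a)
  have hdeg' : (z.snd * star G).natDegree ≤ (p * N).natDegree := by
    have hpG : z.fst.natDegree = p.natDegree + G.natDegree := by
      rw [hG, natDegree_mul (by simpa [algebraMap_injective] using hp) hG0, natDegree_algebraMap]
    have hQG := natDegree_mul_le (p := z.snd) (q := star G)
    rw [natDegree_star] at hQG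
    rw [natDegree_mul hp hN0, natDegree_eq_of_algebraMap_eq_mul_star hN]
    omega
  refine mem_factorizableUpToReal_of_mul_ofReal hN0 ?_
  rw [ofParts_mul_ofReal_eq hG hN]
  exact mul_mem (hall.translationFactors (mul_ne_zero hp hN0) (star_mul_star_eq_neg hp hG hdual)
    hdeg') (mem_factorizableUpToReal_of_mem (ofParts_inl_mem_factorizable hG0))

theorem natDegree_snd_le (z : ℍ[ℝ][X][ε]) : z.snd.natDegree ≤ (ofParts z).natDegree := by
  refine natDegree_le_iff_coeff_eq_zero.mpr fun n hn => ?_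
  have hcoeff := congrArg TrivSqZeroExt.snd (coeff_eq_zero_of_natDegree_lt hn)
  simpa [coeff_ofParts] using hcoeff

theorem natDegree_primalPart {F : DualQuat[X]} (hF : IsUnit F.leadingCoeff) :
    (primalPart F).natDegree = F.natDegree :=
  natDegree_map_of_leadingCoeff_ne_zero _
    (TrivSqZeroExt.isUnit_iff_isUnit_fst.mp hF).ne_zero

theorem one_le_natDegree_of_not_isBounded {F : DualQuat[X]} (hP : primalPart F ≠ 0)
    (hF : ¬ IsBounded F) : 1 ≤ F.natDegree := by
  obtain ⟨a, ha⟩ := not_forall_not.mp hF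
  have hmax : IsMaxRealFactor (mrpf (primalPart F)) (primalPart F) := (mrpf_eq_iff hP).mp rfl
  have hpos := natDegree_pos_iff_degree_pos.mpr (degree_pos_of_root hmax.1.ne_zero ha)
  obtain ⟨G, hG⟩ := hmax.2.1
  have hle : (primalPart F).natDegree ≤ F.natDegree := natDegree_map_le
  rw [hG] at hP
  rw [hG, natDegree_mul (left_ne_zero_of_mul hP) (right_ne_zero_of_mul hP), natDegree_map] at hle
  omega

theorem monic_list_prod_X_sub_C {R : Type*} [Ring R] (l : List R) :
    (l.map fun x => X - C x).prod.Monic := by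
  induction l with
  | nil => exact monic_one
  | cons x l ih => exact (monic_X_sub_C x).mul ih

theorem natDegree_list_prod_X_sub_C {R : Type*} [Ring R] [Nontrivial R] (l : List R) :
    (l.map fun x => X - C x).prod.natDegree = l.length := by
  induction l with
  | nil => exact natDegree_one
  | cons x l ih =>
    rw [List.map_cons, List.prod_cons, (monic_X_sub_C x).natDegree_mul
      (monic_list_prod_X_sub_C l), ih, natDegree_X_sub_C, List.length_cons, add_comm]

theorem admitsMotionFactorization_of_mem {F : DualQuat[X]} (hF : F ∈ factorizable)
    (hdeg : 1 ≤ F.natDegree) : AdmitsMotionFactorization F := by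
  obtain ⟨c, hc, l, hl, rfl⟩ := hF
  have hc0 : c ≠ 0 := by
    obtain ⟨c', -, hcc', -⟩ := hc.exists_inverse_of_C
    exact left_ne_zero_of_mul_eq_one hcc'
  refine ⟨hdeg, c, l, ?_, hl, rfl⟩
  rw [natDegree_C_mul_of_mul_ne_zero (by rwa [monic_list_prod_X_sub_C, mul_one]),
    natDegree_list_prod_X_sub_C]

theorem natDegree_le_natDegree_mul_ofReal {F : DualQuat[X]} (hF : IsUnit F.leadingCoeff)
    {D : ℝ[X]} (hD : D ≠ 0) : F.natDegree ≤ (F * ofReal D).natDegree := by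
  have hD' : ofReal D ≠ 0 := (map_ne_zero_iff _ algebraMap_injective).mpr hD
  rw [natDegree_mul' (by rwa [Ne, hF.mul_right_eq_zero, leadingCoeff_eq_zero])]
  exact Nat.le_add_right _ _

end MotionPoly

theorem mainTheorem2_general (F : Polynomial MotionPoly.DualQuat)
    (hlead : IsUnit F.leadingCoeff)
    (hmotion : MotionPoly.IsMotionPolynomial F)
    (hdeg : 1 ≤ F.natDegree)
    (hmult : ∀ a : ℝ, (MotionPoly.mrpf (MotionPoly.primalPart F)).IsRoot a →
      (MotionPoly.mrpf (MotionPoly.primalPart F)).rootMultiplicity a = 1) :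
    ∃ D : Polynomial ℝ, D ≠ 0 ∧
      MotionPoly.AdmitsMotionFactorization (F * MotionPoly.ofReal D) := by
  obtain ⟨z, rfl⟩ := MotionPoly.ofParts_surjective F
  have hparts : z.snd.natDegree ≤ z.fst.natDegree := by
    rw [← MotionPoly.primalPart_ofParts, MotionPoly.natDegree_primalPart hlead]
    exact MotionPoly.natDegree_snd_le z
  rw [MotionPoly.primalPart_ofParts] at hmult
  obtain ⟨D, hD, hfactor⟩ := MotionPoly.mem_factorizableUpToReal hmotion hparts hmult
  exact ⟨D, hD, MotionPoly.admitsMotionFactorization_of_mem hfactor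
    (hdeg.trans (MotionPoly.natDegree_le_natDegree_mul_ofReal hlead hD))⟩

theorem mainTheorem2 (F : Polynomial MotionPoly.DualQuat)
    (hlead : IsUnit F.leadingCoeff)
    (hmotion : MotionPoly.IsMotionPolynomial F)
    (hunbounded : ¬ MotionPoly.IsBounded F)
    (hmult : ∀ a : ℝ, (MotionPoly.mrpf (MotionPoly.primalPart F)).IsRoot a →
      (MotionPoly.mrpf (MotionPoly.primalPart F)).rootMultiplicity a = 1) :
    ∃ D : Polynomial ℝ, D ≠ 0 ∧
      MotionPoly.AdmitsMotionFactorization (F * MotionPoly.ofReal D) :=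
  mainTheorem2_general F hlead hmotion
    (MotionPoly.one_le_natDegree_of_not_isBounded hmotion.primalPart_ne_zero hunbounded) hmult
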